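/- For $k\in\mathbb N$, a $k$-dimensional vector addition system with states ($k$-VASS) $V$ consists of a finite alphabet $\Sigma$, a finite set $Q$ of states, an initial configuration $c_0\in Q\times\mathbb N^k$, a finite set $F\subseteq Q\times\mathbb N^k$ of final configurations, and a finite transition relation $\delta\subseteq Q\times\Sigma\times\mathbb Z^k\times Q$. A transition $(s,a,v,s')\in\delta$ reads the letter $a$; it can be fired in a configuration $(q,u)\in Q\times\mathbb N^k$ if and only if $q=s$ and $u+v\ge 0$ componentwise, and it then leads to the configuration $(s',u+v)$. A run is a sequence of transitions that can be fired one after another; it is over the word formed by the letters it reads. A configuration $(q,u)$ is accepting if there is $(q,u')\in F$ with $u\ge u'$ componentwise (coverability acceptance). The language $L(V)\subseteq\Sigma^*$ is the set of all words read by runs from $c_0$ to an accepting configuration. The VASS $V$ is deterministic if for every $q\in Q$ and $a\in\Sigma$ at most one transition over $a$ leaves $q$. A resolver for $V$ is a function which, given a history (a finite sequence of pairs of a configuration and the transition taken in it), a current configuration and a letter $a$, returns a transition of $V$ over $a$ that can be fired in the current configuration, whenever there is one. The VASS $V$ is history-deterministic if there is a resolver such that, for every $w\in L(V)$, the run over $w$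 from $c_0$ that follows the resolver letter by letter exists and is accepting. The following problem is undecidable: given a deterministic $2$-VASS $A$ and a history-deterministic $2$-VASS $B$ over the same finite alphabet (both given by finite descriptions that list their final configurations and their transitions), is $L(A)=L(B)$? That is, there is no algorithm which, on every input consisting of a deterministic $2$-VASS $A$ and a history-deterministic $2$-VASS $B$ over the same finite alphabet, halts and correctly answers whether $L(A)=L(B)$; nothing is required of the algorithm on other inputs. -/

import Mathlib

/-- A transition `(src, letter, eff, tgt)` of a `k`-dimensional VASS with alphabet `α` and
state set `Q`. -/
structure VASSTransition (k : ℕ) (α Q : Type) where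
  src : Q
  letter : α
  eff : Fin k → ℤ
  tgt : Q

/-- A configuration `q(u)`: a state together with the values of the `k` nonnegative counters. -/
abbrev VASSConfig (k : ℕ) (Q : Type) : Type := Q × (Fin k → ℕ)

/-- A history of a run: the configurations passed so far, each with the transition taken there,
in chronological order. -/
abbrev VASSHistory (k : ℕ) (α Q : Type) : Type :=
  List (VASSConfig k Q × VASSTransition k α Q)

/-- A `k`-dimensional vector addition system with states over the alphabet `α` with state set `Q`
(the theorem takes `α` and `Q` to be finite). -/
structure VASS (k : ℕ) (α Q : Type) where
  init : VASSConfig k Q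
  final : Finset (VASSConfig k Q)
  trans : Finset (VASSTransition k α Q)

namespace VASS

variable {k : ℕ} {α Q : Type}

/-- `t` is a transition of `V` that can be fired in `c`, and firing it leads to `c'`. The counters
of `c'` are natural numbers, so no counter drops below zero. -/
def Step (V : VASS k α Q) (c : VASSConfig k Q) (t : VASSTransition k α Q)
    (c' : VASSConfig k Q) : Prop :=
  t ∈ V.trans ∧ t.src = c.1 ∧ t.tgt = c'.1 ∧ ∀ i, (c'.2 i : ℤ) = (c.2 i : ℤ) + t.eff i

/-- `V.Run c ρ c'`: the sequence of transitions `ρ` is a run of `V` from `c` to `c'`. -/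
inductive Run (V : VASS k α Q) :
    VASSConfig k Q → List (VASSTransition k α Q) → VASSConfig k Q → Prop
  | nil (c : VASSConfig k Q) : Run V c [] c
  | cons {c c' c'' : VASSConfig k Q} {t : VASSTransition k α Q}
      {ρ : List (VASSTransition k α Q)} :
      V.Step c t c' → Run V c' ρ c'' → Run V c (t :: ρ) c''

/-- A configuration is accepting if it covers some final configuration. -/
def Accepting (V : VASS k α Q) (c : VASSConfig k Q) : Prop :=
  ∃ v : Fin k → ℕ, (c.1, v) ∈ V.final ∧ v ≤ c.2

/-- The coverability language: the words read by runs from the initial configuration to an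
accepting one. -/
def language (V : VASS k α Q) : Language α :=
  {w | ∃ (ρ : List (VASSTransition k α Q)) (c : VASSConfig k Q),
    V.Run V.init ρ c ∧ V.Accepting c ∧ ρ.map VASSTransition.letter = w}

/-- At most one transition leaves each state over each letter. -/
def IsDeterministic (V : VASS k α Q) : Prop :=
  ∀ t ∈ V.trans, ∀ t' ∈ V.trans, t.src = t'.src → t.letter = t'.letter → t = t'

/-- `r` is a resolver: given a history, a current configuration and a next letter, it returns a
transition over this letter which can be fired from the current configuration. The value `none`
is allowed only where there is no such transition. -/
def IsResolver (V : VASS k α Q)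
    (r : VASSHistory k α Q → VASSConfig k Q → α → Option (VASSTransition k α Q)) : Prop :=
  ∀ h c a,
    (∀ t, r h c a = some t → t.letter = a ∧ ∃ c', V.Step c t c') ∧
    (r h c a = none → ¬ ∃ t c', t.letter = a ∧ V.Step c t c')

/-- `V.ResolvedRun r w h c`: the run over `w` from the initial configuration given by `r` exists,
its history is `h`, and it ends in `c`. -/
inductive ResolvedRun (V : VASS k α Q)
    (r : VASSHistory k α Q → VASSConfig k Q → α → Option (VASSTransition k α Q)) :
    List α → VASSHistory k α Q → VASSConfig k Q → Prop
  | nil : ResolvedRun V r [] [] V.init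
  | snoc {w : List α} {h : VASSHistory k α Q} {c c' : VASSConfig k Q} {a : α}
      {t : VASSTransition k α Q} :
      ResolvedRun V r w h c → r h c a = some t → V.Step c t c' →
      ResolvedRun V r (w ++ [a]) (h ++ [(c, t)]) c'

/-- Some resolver gives an accepting run over every word of the language. -/
def IsHistoryDeterministic (V : VASS k α Q) : Prop :=
  ∃ r : VASSHistory k α Q → VASSConfig k Q → α → Option (VASSTransition k α Q),
    V.IsResolver r ∧ ∀ w ∈ V.language, ∃ h c, V.ResolvedRun r w h c ∧ V.Accepting c

end VASS

/-- The finite descriptions of `k`-VASSs that are given to an algorithm: the number of letters,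
the number of states, the initial configuration, a list of the final configurations and a list of
the transitions. Letters and states are written as natural numbers. -/
abbrev VASSCode (k : ℕ) : Type :=
  ℕ × ℕ × (ℕ × (Fin k → ℕ)) × List (ℕ × (Fin k → ℕ)) × List (ℕ × ℕ × (Fin k → ℤ) × ℕ)

/-- `c` is a description of the VASS `V` with `m` letters and `n` states: its two lists enumerate,
in any order, exactly the final configurations and the transitions of `V`. -/
def VASS.IsDescribedBy {k m n : ℕ} (V : VASS k (Fin m) (Fin n)) (c : VASSCode k) : Prop :=
  c.1 = m ∧ c.2.1 = n ∧ c.2.2.1 = ((V.init.1 : ℕ), V.init.2) ∧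
  (∀ x, x ∈ c.2.2.2.1 ↔ ∃ f ∈ V.final, x = ((f.1 : ℕ), f.2)) ∧
  (∀ x, x ∈ c.2.2.2.2 ↔
    ∃ t ∈ V.trans, x = ((t.src : ℕ), (t.letter : ℕ), t.eff, (t.tgt : ℕ)))

/-! A counter program is a regular language of words over increments, decrements and zero tests; it
halts if one of its words is executable. Programs with arbitrarily many counters compute all
primitive recursive functions, hence semidecide every recursively enumerable predicate, and storing
the counters `s` as a Gödel number `∏ i, p i ^ s i` reduces the number of counters to two.

A VASS cannot test for zero. Let `A` be the deterministic VASS which reads the words of a program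
and executes their increments and decrements, ignoring the tests. Let `B` do the same, except
that it accepts only if at some point a test of a nonzero counter was read: `B` proves that the
counter is nonzero by decrementing it, and it restores the counter in the next step. Ignoring the
tests, every word determines the counter values, so a resolver recognises the first wrong test
when it occurs and `B` is history-deterministic. A word of `L(A)` is missing from `L(B)` exactly
if all its tests are right, so `L(A) = L(B)` if and only if the program does not halt. -/

open scoped Computability
open RegularExpression (char)

section RegularLanguages

variable {α : Type*}

theorem leftQuotient_mul (L M : Language α) (x : List α) :
    (L * M).leftQuotient x = L.leftQuotient x * M +
      sSup {N | ∃ u ∈ L, ∃ v, x = u ++ v ∧ N = M.leftQuotient v} := by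
  ext y
  refine Iff.trans ?_ (or_congr Iff.rfl Set.mem_sUnion).symm
  constructor
  · rintro ⟨a, ha, b, hb, hab⟩
    rcases List.append_eq_append_iff.1 hab with ⟨c, rfl, rfl⟩ | ⟨c, rfl, rfl⟩
    · exact .inr ⟨_, ⟨a, ha, c, rfl, rfl⟩, hb⟩
    · exact .inl ⟨c, ha, b, hb, rfl⟩
  · rintro (⟨a, ha, b, hb, rfl⟩ | ⟨_, ⟨u, hu, v, rfl, rfl⟩, hy⟩)
    · exact ⟨x ++ a, ha, b, hb, List.append_assoc ..⟩
    · exact ⟨u, hu, v ++ y, hy, (List.append_assoc ..).symm⟩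

theorem append_mem_kstar {L : Language α} {x y : List α} (hx : x ≠ []) :
    x ++ y ∈ L∗ ↔ ∃ u ∈ L∗, ∃ v y₁ y₂, x = u ++ v ∧ y = y₁ ++ y₂ ∧ v ++ y₁ ∈ L ∧ y₂ ∈ L∗ := by
  simp only [Language.mem_kstar]
  constructor
  · rintro ⟨l, hxy, hl⟩
    rcases List.flatten_eq_append_iff.1 hxy.symm with
      ⟨as, bs, rfl, rfl, rfl⟩ | ⟨as, v, b, bs, cs, rfl, rfl, rfl⟩
    · have has : as ≠ [] := by rintro rfl; exact hx rfl
      obtain ⟨as, v, rfl⟩ := as.eq_nil_or_concat.resolve_left has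
      simp only [List.concat_eq_append, List.mem_append, List.mem_singleton] at hl
      exact ⟨as.flatten, ⟨as, rfl, fun z hz => hl z (by tauto)⟩, v, [], bs.flatten, by simp,
        rfl, by simpa using hl v (by tauto), bs, rfl, fun z hz => hl z (by tauto)⟩
    · simp only [List.mem_append, List.mem_cons] at hl
      exact ⟨as.flatten, ⟨as, rfl, fun z hz => hl z (by tauto)⟩, v, b :: bs, cs.flatten, rfl,
        rfl, hl _ (by tauto), cs, rfl, fun z hz => hl z (by tauto)⟩
  · rintro ⟨_, ⟨as, rfl, has⟩, v, y₁, _, rfl, rfl, hvy, cs, rfl, hcs⟩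
    refine ⟨as ++ (v ++ y₁) :: cs, by simp, fun z hz => ?_⟩
    rcases List.mem_append.1 hz with hz | hz
    · exact has z hz
    · rcases List.mem_cons.1 hz with rfl | hz
      exacts [hvy, hcs z hz]

theorem leftQuotient_kstar (L : Language α) {x : List α} (hx : x ≠ []) :
    (L∗).leftQuotient x =
      sSup {N | ∃ u ∈ L∗, ∃ v, x = u ++ v ∧ N = L.leftQuotient v} * L∗ := by
  ext y
  rw [Language.mem_leftQuotient, append_mem_kstar hx]
  constructor
  · rintro ⟨u, hu, v, y₁, y₂, hx, rfl, hvy, hy⟩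
    exact ⟨y₁, Set.mem_sUnion.2 ⟨_, ⟨u, hu, v, hx, rfl⟩, hvy⟩, y₂, hy, rfl⟩
  · rintro ⟨y₁, hy₁, y₂, hy₂, rfl⟩
    obtain ⟨_, ⟨u, hu, v, hx, rfl⟩, hvy⟩ := Set.mem_sUnion.1 hy₁
    exact ⟨u, hu, v, y₁, y₂, hx, rfl, hvy, hy₂⟩

theorem isRegular_mul {L M : Language α} (hL : L.IsRegular) (hM : M.IsRegular) :
    (L * M).IsRegular := by
  refine .of_finite_range_leftQuotient (Set.Finite.subset
    (Set.Finite.image2 (fun (A : Language α) (S : Set (Language α)) => A * M + sSup S)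
      hL.finite_range_leftQuotient hM.finite_range_leftQuotient.powerset) ?_)
  rintro _ ⟨x, rfl⟩
  refine ⟨_, ⟨x, rfl⟩, _, ?_, (leftQuotient_mul L M x).symm⟩
  rintro _ ⟨u, -, v, -, rfl⟩
  exact ⟨v, rfl⟩

theorem isRegular_kstar {L : Language α} (hL : L.IsRegular) : (L∗).IsRegular := by
  refine .of_finite_range_leftQuotient (Set.Finite.subset (Set.Finite.insert L∗
    (Set.Finite.image (fun S : Set (Language α) => sSup S * L∗)
      hL.finite_range_leftQuotient.powerset)) ?_)
  rintro _ ⟨x, rfl⟩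
  by_cases hx : x = []
  · exact .inl (by rw [hx, Language.leftQuotient_nil])
  · refine .inr ⟨_, ?_, (leftQuotient_kstar L hx).symm⟩
    rintro _ ⟨u, -, v, -, rfl⟩
    exact ⟨v, rfl⟩

theorem isRegular_of_finite {L : Language α} (hL : Set.Finite (L : Set (List α))) :
    L.IsRegular := by
  have hsuffix : {y | ∃ x, x ++ y ∈ L}.Finite :=
    (hL.biUnion fun w _ => w.tails.finite_toSet).subset fun y ⟨x, hxy⟩ =>
      Set.mem_biUnion hxy ((List.mem_tails _ _).2 ⟨x, rfl⟩)
  refine .of_finite_range_leftQuotient (hsuffix.powerset.subset ?_)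
  rintro _ ⟨x, rfl⟩ y hy
  exact ⟨x, hy⟩

theorem isRegular_matches' (P : RegularExpression α) : P.matches'.IsRegular := by
  induction P with
  | zero => exact isRegular_of_finite Set.finite_empty
  | epsilon => exact isRegular_of_finite (Set.finite_singleton [])
  | char a => exact isRegular_of_finite (Set.finite_singleton [a])
  | plus P Q hP hQ => exact hP.add hQ
  | comp P Q hP hQ => exact isRegular_mul hP hQ
  | star P hP => exact isRegular_kstar hP

end RegularLanguages

section RelationalSemantics

variable {α β S S' : Type*}

/-- The relation induced by a word whose letters act as relations on a state space. -/
def Exec (ρ : α → S → S → Prop) : List α → S → S → Prop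
  | [] => Eq
  | a :: w => Relation.Comp (ρ a) (Exec ρ w)

theorem exec_append (ρ : α → S → S → Prop) (w w' : List α) :
    Exec ρ (w ++ w') = Relation.Comp (Exec ρ w) (Exec ρ w') := by
  induction w with
  | nil => exact Relation.eq_comp.symm
  | cons a w ih => rw [List.cons_append, Exec, Exec, ih, Relation.comp_assoc]

theorem exec_concat (ρ : α → S → S → Prop) (w : List α) (a : α) :
    Exec ρ (w ++ [a]) = Relation.Comp (Exec ρ w) (ρ a) := by
  rw [exec_append, Exec, Exec, Relation.comp_eq]

theorem exec_map (ρ : β → S → S → Prop) (f : α → β) (w : List α) :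
    Exec ρ (w.map f) = Exec (fun a => ρ (f a)) w := by
  induction w with
  | nil => rfl
  | cons a w ih => rw [List.map_cons, Exec, Exec, ih]

theorem Exec.mono {ρ ρ' : α → S → S → Prop} (h : ∀ a s t, ρ a s t → ρ' a s t) {w : List α}
    {s t : S} (hw : Exec ρ w s t) : Exec ρ' w s t := by
  induction w generalizing s with
  | nil => exact hw
  | cons a w ih =>
    obtain ⟨u, hsu, hut⟩ := hw
    exact ⟨u, h a s u hsu, ih hut⟩

theorem Exec.rightUnique {ρ : α → S → S → Prop} (h : ∀ a, Relator.RightUnique (ρ a))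
    (w : List α) : Relator.RightUnique (Exec ρ w) := by
  induction w with
  | nil => exact fun _ _ _ hst hst' => hst.symm.trans hst'
  | cons a w ih =>
    rintro s t t' ⟨u, hsu, hut⟩ ⟨u', hsu', hut'⟩
    obtain rfl := h a hsu hsu'
    exact ih hut hut'

/-- The input-output relation of a regular expression read as a nondeterministic program whose
elementary instructions act as the relations `ρ a`. -/
def Denote (ρ : α → S → S → Prop) : RegularExpression α → S → S → Prop
  | 0 => fun _ _ => False
  | 1 => Eq
  | char a => ρ a
  | P + Q => fun s t => Denote ρ P s t ∨ Denote ρ Q s t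
  | P * Q => Relation.Comp (Denote ρ P) (Denote ρ Q)
  | .star P => Relation.ReflTransGen (Denote ρ P)

theorem denote_star_iff {ρ : α → S → S → Prop} {P : RegularExpression α}
    (hP : ∀ s t, Denote ρ P s t ↔ ∃ w ∈ P.matches', Exec ρ w s t) (s t : S) :
    Denote ρ P.star s t ↔ ∃ w ∈ P.star.matches', Exec ρ w s t := by
  rw [RegularExpression.matches'_star]
  constructor
  · intro h
    induction h using Relation.ReflTransGen.head_induction_on with
    | refl => exact ⟨[], Language.nil_mem_kstar _, rfl⟩
    | head hsu _ ih =>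
      obtain ⟨w, hw, hsu⟩ := (hP _ _).1 hsu
      obtain ⟨_, ⟨l, rfl, hl⟩, hut⟩ := ih
      exact ⟨w ++ l.flatten, ⟨w :: l, rfl, List.forall_mem_cons.2 ⟨hw, hl⟩⟩,
        (exec_append ρ w _).symm ▸ ⟨_, hsu, hut⟩⟩
  · rintro ⟨_, ⟨l, rfl, hl⟩, h⟩
    induction l generalizing s with
    | nil => exact h ▸ .refl
    | cons w l ih =>
      obtain ⟨hw, hl⟩ := List.forall_mem_cons.1 hl
      obtain ⟨u, hsu, hut⟩ := exec_append ρ w _ ▸ h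
      exact .head ((hP s u).2 ⟨w, hw, hsu⟩) (ih u hl hut)

theorem denote_iff_exists_mem_matches' (ρ : α → S → S → Prop) (P : RegularExpression α) (s t : S) :
    Denote ρ P s t ↔ ∃ w ∈ P.matches', Exec ρ w s t := by
  induction P generalizing s t with
  | zero => exact ⟨False.elim, fun ⟨_, hw, _⟩ => hw⟩
  | epsilon => exact ⟨fun h => ⟨[], rfl, h⟩, by rintro ⟨_, rfl, h⟩; exact h⟩
  | char a =>
    exact ⟨fun h => ⟨[a], rfl, t, h, rfl⟩, by rintro ⟨_, rfl, _, h, rfl⟩; exact h⟩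
  | plus P Q hP hQ =>
    simp only [RegularExpression.plus_def, Denote, RegularExpression.matches'_add, hP, hQ,
      Language.mem_add, or_and_right, exists_or]
  | comp P Q hP hQ =>
    simp only [RegularExpression.comp_def, Denote, RegularExpression.matches'_mul, Relation.Comp,
      hP, hQ, Language.mem_mul]
    constructor
    · rintro ⟨u, ⟨w, hw, hsu⟩, w', hw', hut⟩
      exact ⟨_, ⟨w, hw, w', hw', rfl⟩, (exec_append ρ w w').symm ▸ ⟨u, hsu, hut⟩⟩
    · rintro ⟨_, ⟨w, hw, w', hw', rfl⟩, h⟩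
      obtain ⟨u, hsu, hut⟩ := exec_append ρ w w' ▸ h
      exact ⟨u, ⟨w, hw, hsu⟩, w', hw', hut⟩
  | star P hP => exact denote_star_iff hP s t

/-- Replaces every letter `a` of a regular expression by the regular expression `f a`. -/
def regexSubst (f : α → RegularExpression β) : RegularExpression α → RegularExpression β
  | 0 => 0
  | 1 => 1
  | char a => f a
  | P + Q => regexSubst f P + regexSubst f Q
  | P * Q => regexSubst f P * regexSubst f Q
  | .star P => (regexSubst f P).star

theorem denote_regexSubst (ρ : β → S → S → Prop) (f : α → RegularExpression β)
    (P : RegularExpression α) :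
    Denote ρ (regexSubst f P) = Denote (fun a => Denote ρ (f a)) P := by
  induction P with
  | zero | epsilon | char a => rfl
  | plus P Q hP hQ => simp only [regexSubst, Denote, hP, hQ]
  | comp P Q hP hQ => simp only [regexSubst, Denote, hP, hQ]
  | star P hP => simp only [regexSubst, Denote, hP]

theorem denote_simulation {ρ : α → S → S → Prop} {ρ' : α → S' → S' → Prop} {E : S → S' → Prop}
    (h : ∀ a s s' t, E s s' → ρ a s t → ∃ t', ρ' a s' t' ∧ E t t') {P : RegularExpression α}
    {s t : S} {s' : S'} (hs : E s s') (hst : Denote ρ P s t) :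
    ∃ t', Denote ρ' P s' t' ∧ E t t' := by
  induction P generalizing s s' t with
  | zero => exact hst.elim
  | epsilon => exact ⟨s', rfl, (hst : s = t) ▸ hs⟩
  | char a => exact h a s s' t hs hst
  | plus P Q hP hQ =>
    rcases hst with hst | hst
    · exact (hP hs hst).imp fun _ => And.imp_left .inl
    · exact (hQ hs hst).imp fun _ => And.imp_left .inr
  | comp P Q hP hQ =>
    obtain ⟨u, hsu, hut⟩ := hst
    obtain ⟨u', hsu', hu⟩ := hP hs hsu
    obtain ⟨t', hut', ht⟩ := hQ hu hut
    exact ⟨t', ⟨u', hsu', hut'⟩, ht⟩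
  | star P hP =>
    induction (hst : Relation.ReflTransGen (Denote ρ P) s t) with
    | refl => exact ⟨s', .refl, hs⟩
    | tail _ hut ih =>
      obtain ⟨u', hsu', hu⟩ := ih
      obtain ⟨t', hut', ht⟩ := hP hu hut
      exact ⟨t', .tail hsu' hut', ht⟩

theorem denote_prod_map_char (ρ : α → S → S → Prop) (w : List α) :
    Denote ρ (w.map char).prod = Exec ρ w := by
  induction w with
  | nil => rfl
  | cons a w ih => rw [List.map_cons, List.prod_cons, Exec, ← ih]; rfl

theorem denote_list_sum {ρ : α → S → S → Prop} {l : List (RegularExpression α)} {s t : S} :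
    Denote ρ l.sum s t ↔ ∃ P ∈ l, Denote ρ P s t := by
  induction l with
  | nil => exact ⟨False.elim, by simp⟩
  | cons P l ih =>
    rw [List.sum_cons, List.exists_mem_cons_iff, ← ih]
    rfl

/-- Total correctness: `P` can be executed from `s`, and every execution ends in a state satisfying
`Q`. -/
def Ensures (ρ : α → S → S → Prop) (P : RegularExpression α) (s : S) (Q : S → Prop) : Prop :=
  (∃ t, Denote ρ P s t) ∧ ∀ t, Denote ρ P s t → Q t

theorem ensures_eq {ρ : α → S → S → Prop} {P : RegularExpression α} {s u : S}
    (h : ∀ t, Denote ρ P s t ↔ t = u) : Ensures ρ P s (· = u) :=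
  ⟨⟨u, (h u).2 rfl⟩, fun t => (h t).1⟩

theorem Ensures.mono {ρ : α → S → S → Prop} {P : RegularExpression α} {s : S} {Q Q' : S → Prop}
    (h : Ensures ρ P s Q) (hQ : ∀ t, Q t → Q' t) : Ensures ρ P s Q' :=
  ⟨h.1, fun t ht => hQ t (h.2 t ht)⟩

theorem Ensures.mul {ρ : α → S → S → Prop} {P P' : RegularExpression α} {s : S} {Q Q' : S → Prop}
    (h : Ensures ρ P s Q) (h' : ∀ u, Q u → Ensures ρ P' u Q') : Ensures ρ (P * P') s Q' := by
  obtain ⟨u, hu⟩ := h.1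
  obtain ⟨t, ht⟩ := (h' u (h.2 u hu)).1
  exact ⟨⟨t, u, hu, ht⟩, fun t ⟨u, hu, ht⟩ => (h' u (h.2 u hu)).2 t ht⟩

theorem Ensures.mul_of_eq {ρ : α → S → S → Prop} {P P' : RegularExpression α} {s u : S}
    {Q : S → Prop} (h : Ensures ρ P s (· = u)) (h' : Ensures ρ P' u Q) : Ensures ρ (P * P') s Q :=
  h.mul fun _ hu => hu ▸ h'

end RelationalSemantics

section CounterInstructions

/-- The elementary instructions on counters indexed by `ι`: increment a counter, decrement a nonzero
counter, and check that a counter is zero. -/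
inductive Instr (ι : Type*)
  | inc (i : ι)
  | dec (i : ι)
  | test (i : ι)

namespace Instr

variable {ι : Type*}

instance [Finite ι] : Finite (Instr ι) :=
  .of_surjective (Sum.elim inc (Sum.elim dec test) : ι ⊕ ι ⊕ ι → Instr ι) fun
    | inc i => ⟨.inl i, rfl⟩
    | dec i => ⟨.inr (.inl i), rfl⟩
    | test i => ⟨.inr (.inr i), rfl⟩

variable [DecidableEq ι]

/-- The exact effect of an instruction on the counters. -/
def Step : Instr ι → (ι → ℕ) → (ι → ℕ) → Prop
  | inc i, s, t => t = Function.update s i (s i + 1)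
  | dec i, s, t => s i ≠ 0 ∧ t = Function.update s i (s i - 1)
  | test i, s, t => s i = 0 ∧ t = s

/-- The vector which an instruction adds to the counters. -/
def effect : Instr ι → ι → ℤ
  | inc i => Pi.single i 1
  | dec i => Pi.single i (-1)
  | test _ => 0

/-- The effect of an instruction on the counters of a VASS, which cannot check zero tests. -/
def WeakStep (a : Instr ι) (s t : ι → ℕ) : Prop :=
  ∀ i, (t i : ℤ) = s i + a.effect i

theorem step_iff {a : Instr ι} {s t : ι → ℕ} :
    a.Step s t ↔ a.WeakStep s t ∧ ∀ i, a = test i → s i = 0 := by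
  cases a with
  | inc i =>
    simp only [Step, WeakStep, effect, reduceCtorEq, false_imp_iff, implies_true, and_true,
      funext_iff]
    grind [Function.update_apply]
  | dec i =>
    simp only [Step, WeakStep, effect, reduceCtorEq, false_imp_iff, implies_true, and_true,
      funext_iff]
    grind [Function.update_apply]
  | test i => simp [Step, WeakStep, effect, funext_iff, and_comm]

theorem Step.weakStep {a : Instr ι} {s t : ι → ℕ} (h : a.Step s t) : a.WeakStep s t :=
  (step_iff.1 h).1

theorem weakStep_rightUnique (a : Instr ι) : Relator.RightUnique a.WeakStep :=
  fun _ _ _ h h' => funext fun i => by exact_mod_cast (h i).trans (h' i).symm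

end Instr

variable {ι : Type*} [DecidableEq ι]

theorem exec_weakStep_rightUnique {α : Type*} (op : α → Instr ι) (w : List α) :
    Relator.RightUnique (Exec (fun a => (op a).WeakStep) w) :=
  Exec.rightUnique (fun a => (op a).weakStep_rightUnique) w

theorem exec_replicate_dec_iff {n : ℕ} {i : ι} {s t : ι → ℕ} :
    Exec Instr.Step (.replicate n (.dec i)) s t ↔ n ≤ s i ∧ t = Function.update s i (s i - n) := by
  induction n generalizing s with
  | zero => simp [Exec, eq_comm]
  | succ n ih =>
    simp only [List.replicate_succ, Exec, Relation.Comp, Instr.Step, ih]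
    constructor
    · rintro ⟨_, ⟨hi, rfl⟩, hn, rfl⟩
      simp only [Function.update_self, Function.update_idem] at hn ⊢
      exact ⟨by omega, by rw [Nat.sub_sub, Nat.add_comm]⟩
    · rintro ⟨hn, rfl⟩
      refine ⟨_, ⟨by omega, rfl⟩, ?_⟩
      simp only [Function.update_self, Function.update_idem]
      exact ⟨by omega, by rw [Nat.sub_sub, Nat.add_comm]⟩

theorem exec_map_inc_iff {l : List ι} {s t : ι → ℕ} :
    Exec Instr.Step (l.map .inc) s t ↔ t = fun x => s x + l.count x := by
  induction l generalizing s with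
  | nil => simp [Exec, eq_comm]
  | cons i l ih =>
    simp only [List.map_cons, Exec, Relation.Comp, Instr.Step, ih, exists_eq_left]
    refine Eq.congr rfl (funext fun x => ?_)
    simp only [Function.update_apply, List.count_cons, beq_iff_eq]
    grind

/-- Takes `n` units from the counter `i` and adds one unit to each counter in the list `l`. -/
def transfer (n : ℕ) (i : ι) (l : List ι) : RegularExpression (Instr ι) :=
  ((List.replicate n (Instr.dec i) ++ l.map Instr.inc).map char).prod

theorem denote_transfer_iff {n : ℕ} {i : ι} {l : List ι} {s t : ι → ℕ} :
    Denote Instr.Step (transfer n i l) s t ↔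
      n ≤ s i ∧ t = fun x => Function.update s i (s i - n) x + l.count x := by
  rw [transfer, denote_prod_map_char, exec_append]
  simp only [Relation.Comp, exec_replicate_dec_iff, exec_map_inc_iff, and_assoc, exists_and_left,
    exists_eq_left]

/-- Repeats `transfer n i l` until the counter `i` is zero. -/
def drain (n : ℕ) (i : ι) (l : List ι) : RegularExpression (Instr ι) :=
  (transfer n i l).star * char (.test i)

theorem denote_drain_iff {n : ℕ} {i : ι} {l : List ι} (hi : i ∉ l) {s t : ι → ℕ} :
    Denote Instr.Step (drain n i l) s t ↔
      ∃ k, s i = n * k ∧ t = fun x => if x = i then 0 else s x + k * l.count x := by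
  constructor
  · rintro ⟨u, hsu : Relation.ReflTransGen _ s u, hu, rfl⟩
    suffices ∃ k, s i = t i + n * k ∧ ∀ x, x ≠ i → t x = s x + k * l.count x by
      obtain ⟨k, hk, ht⟩ := this
      refine ⟨k, by rw [hk, hu, zero_add], funext fun x => ?_⟩
      split_ifs with hx
      exacts [hx ▸ hu, ht x hx]
    clear hu
    induction hsu with
    | refl => exact ⟨0, by simp⟩
    | tail _ hut ih =>
      obtain ⟨k, hk, hu⟩ := ih
      obtain ⟨hn, rfl⟩ := denote_transfer_iff.1 hut
      refine ⟨k + 1, ?_, fun x hx => ?_⟩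
      · simp only [hk, Function.update_self, List.count_eq_zero_of_not_mem hi]
        rw [Nat.mul_succ]
        omega
      · simp only [Function.update_of_ne hx, hu x hx]
        ring
  · rintro ⟨k, hk, rfl⟩
    refine ⟨_, ?_, if_pos rfl, rfl⟩
    change Relation.ReflTransGen _ _ _
    induction k generalizing s with
    | zero =>
      convert Relation.ReflTransGen.refl using 1
      refine funext fun x => ?_
      split_ifs with hx
      exacts [hx ▸ hk.symm, by simp]
    | succ k ih =>
      rw [Nat.mul_succ] at hk
      refine .head (denote_transfer_iff.2 ⟨by omega, rfl⟩) ?_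
      convert ih ?_ using 1
      · refine funext fun x => ?_
        split_ifs with hx
        · rfl
        · rw [Function.update_of_ne hx]
          ring
      · simp only [Function.update_self, List.count_eq_zero_of_not_mem hi]
        omega

end CounterInstructions

section PrimitiveRecursion

variable {ι : Type*} [DecidableEq ι]

theorem ensures_inc (i : ι) (s : ι → ℕ) :
    Ensures Instr.Step (char (.inc i)) s (· = Function.update s i (s i + 1)) :=
  ensures_eq fun _ => Iff.rfl

theorem ensures_drain_one {i : ι} {l : List ι} (hi : i ∉ l) (s : ι → ℕ) :
    Ensures Instr.Step (drain 1 i l) s (· = fun x => if x = i then 0 else s x + s i * l.count x) :=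
  ensures_eq fun t => by simp [denote_drain_iff hi]

/-- Copies the counter `i` to the counter `j` using the scratch counter `k`, which it clears. -/
def assign (i j k : ι) : RegularExpression (Instr ι) :=
  drain 1 j [] * drain 1 k [] * drain 1 i [j, k] * drain 1 k [i]

theorem ensures_assign {i j k : ι} (hij : i ≠ j) (hik : i ≠ k) (hjk : j ≠ k) (s : ι → ℕ) :
    Ensures Instr.Step (assign i j k) s
      (· = Function.update (Function.update s k 0) j (s i)) := by
  have hi : i ∉ [j, k] := by simp [hij, hik]
  have hk : k ∉ [i] := by simp [hik.symm]
  refine ((((ensures_drain_one List.not_mem_nil s).mul_of_eq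
    (ensures_drain_one List.not_mem_nil _)).mul_of_eq (ensures_drain_one hi _)).mul_of_eq
    (ensures_drain_one hk _)).mono ?_
  rintro _ rfl
  ext x
  grind [Function.update_apply]

/-- Repeats `P` as many times as the counter `i` says, counting down. -/
def loop (i : ι) (P : RegularExpression (Instr ι)) : RegularExpression (Instr ι) :=
  (char (Instr.dec i) * P).star * char (.test i)

theorem ensures_loop {i : ι} {P : RegularExpression (Instr ι)} {I : (ι → ℕ) → Prop}
    (hP : ∀ u, I u → u i ≠ 0 →
      Ensures Instr.Step P (Function.update u i (u i - 1)) fun t => I t ∧ t i = u i - 1)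
    {s : ι → ℕ} (hs : I s) : Ensures Instr.Step (loop i P) s fun t => I t ∧ t i = 0 := by
  constructor
  · generalize hn : s i = n
    induction n generalizing s with
    | zero => exact ⟨s, s, .refl, hn, rfl⟩
    | succ n ih =>
      have hsi : s i ≠ 0 := by omega
      obtain ⟨⟨u, hu⟩, hI⟩ := hP s hs hsi
      obtain ⟨hIu, hui⟩ := hI u hu
      obtain ⟨t, v, huv, hvt⟩ := ih hIu (by omega)
      exact ⟨t, v, .head ⟨_, ⟨hsi, rfl⟩, hu⟩ huv, hvt⟩
  · rintro _ ⟨t, hst : Relation.ReflTransGen _ s t, hti, rfl⟩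
    refine ⟨?_, hti⟩
    clear hti
    induction hst with
    | refl => exact hs
    | tail _ hut ih =>
      obtain ⟨_, ⟨hui, rfl⟩, hut⟩ := hut
      exact ((hP _ ih hui).2 _ hut).1

/-- For all locations `arg i` of the arguments below `b` there is a program which writes the value
of `f` to the counter `b` and preserves the counters below `b`. It may use all counters above
`b`, whatever their contents. -/
def Programmable {n : ℕ} (f : List.Vector ℕ n → ℕ) : Prop :=
  ∀ (arg : Fin n → ℕ) (b : ℕ), (∀ i, arg i < b) → ∃ P, ∀ s, Ensures Instr.Step P s fun t =>
    t b = f (.ofFn fun i => s (arg i)) ∧ ∀ j < b, t j = s j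

theorem programmable_zero : Programmable (n := 0) fun _ => 0 := fun _ b _ =>
  ⟨drain 1 b [], fun s => (ensures_drain_one List.not_mem_nil s).mono <| by
    rintro _ rfl
    exact ⟨if_pos rfl, fun j hj => by simp [hj.ne]⟩⟩

theorem programmable_get {n : ℕ} (i : Fin n) : Programmable fun v => v.get i := fun arg b harg =>
  ⟨assign (arg i) b (b + 1), fun s => by
    have hi := harg i
    refine (ensures_assign (by omega) (by omega) (by omega) s).mono ?_
    rintro _ rfl
    refine ⟨by simp, fun j hj => ?_⟩
    rw [Function.update_of_ne (by omega), Function.update_of_ne (by omega)]⟩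

theorem programmable_succ : Programmable (n := 1) fun v => v.head.succ := fun arg b harg => by
  obtain ⟨P, hP⟩ := programmable_get 0 arg b harg
  refine ⟨P * char (.inc b), fun s => (hP s).mul fun u ⟨hub, hu⟩ => (ensures_inc b u).mono ?_⟩
  rintro _ rfl
  refine ⟨?_, fun j hj => ?_⟩
  · rw [Function.update_self, hub]
    simp
  · rw [Function.update_of_ne hj.ne, hu j hj]

theorem exists_program_tuple {m n : ℕ} {g : Fin n → List.Vector ℕ m → ℕ}
    (hg : ∀ i, Programmable (g i)) {arg : Fin m → ℕ} {b : ℕ} (harg : ∀ i, arg i < b) :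
    ∃ P, ∀ s, Ensures Instr.Step P s fun t =>
      (∀ i : Fin n, t (b + i) = g i (.ofFn fun j => s (arg j))) ∧ ∀ j < b, t j = s j := by
  induction n with
  | zero => exact ⟨1, fun s => ⟨⟨s, rfl⟩, by rintro _ rfl; exact ⟨finZeroElim, fun _ _ => rfl⟩⟩⟩
  | succ n ih =>
    obtain ⟨P, hP⟩ := ih fun i => hg i.castSucc
    obtain ⟨P', hP'⟩ := hg (.last n) arg (b + n) fun i => (harg i).trans_le (Nat.le_add_right ..)
    refine ⟨P * P', fun s => (hP s).mul fun u ⟨hu, hus⟩ => (hP' u).mono fun t ⟨ht, htu⟩ => ?_⟩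
    constructor
    · refine Fin.lastCases ?_ fun i => ?_
      · exact ht.trans (by simp only [hus _ (harg _)])
      · exact (htu _ (by simp)).trans (hu i)
    · exact fun j hj => (htu j (by omega)).trans (hus j hj)

theorem programmable_comp {m n : ℕ} {f : List.Vector ℕ n → ℕ} {g : Fin n → List.Vector ℕ m → ℕ}
    (hf : Programmable f) (hg : ∀ i, Programmable (g i)) :
    Programmable fun v => f (.ofFn fun i => g i v) := by
  intro arg b harg
  obtain ⟨P, hP⟩ := exists_program_tuple hg fun i => (harg i).trans (Nat.lt_succ_self b)
  obtain ⟨P', hP'⟩ := hf (fun i => b + 1 + i) (b + 1 + n) fun i => by omega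
  refine ⟨P * (P' * assign (b + 1 + n) b (b + 1 + n + 1)), fun s =>
    (hP s).mul fun u ⟨hu, hus⟩ => (hP' u).mul fun v ⟨hv, hvu⟩ =>
      (ensures_assign (by omega) (by omega) (by omega) v).mono ?_⟩
  rintro _ rfl
  refine ⟨?_, fun j hj => ?_⟩
  · rw [Function.update_self, hv]
    simp only [hu]
  · rw [Function.update_of_ne (by omega), Function.update_of_ne (by omega), hvu j (by omega),
      hus j (by omega)]

theorem exists_program_prec_step {n : ℕ} {g : List.Vector ℕ (n + 2) → ℕ} (hg : Programmable g)
    {arg : Fin n → ℕ} {b : ℕ} (harg : ∀ i, arg i < b) :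
    ∃ P, ∀ s, Ensures Instr.Step P s fun t =>
      t b = g (s (b + 2) ::ᵥ s b ::ᵥ .ofFn fun i => s (arg i)) ∧ t (b + 1) = s (b + 1) ∧
        t (b + 2) = s (b + 2) + 1 ∧ ∀ j < b, t j = s j := by
  obtain ⟨P, hP⟩ := hg (Fin.cons (b + 2) (Fin.cons b arg)) (b + 3) <| by
    simpa [Fin.forall_fin_succ] using fun i => (harg i).trans (by omega)
  refine ⟨P * (assign (b + 3) b (b + 4) * char (.inc (b + 2))), fun s => (hP s).mul
    fun u ⟨hub, hu⟩ => ((ensures_assign (by omega) (by omega) (by omega) u).mul_of_eq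
      (ensures_inc _ _)).mono ?_⟩
  rintro _ rfl
  refine ⟨?_, ?_, ?_, fun j hj => ?_⟩
  · rw [Function.update_of_ne (by omega), Function.update_self]
    exact hub
  · simpa using hu (b + 1) (by omega)
  · simpa using hu (b + 2) (by omega)
  · rw [Function.update_of_ne (by omega), Function.update_of_ne (by omega),
      Function.update_of_ne (by omega), hu j (by omega)]

theorem programmable_prec {n : ℕ} {f : List.Vector ℕ n → ℕ} {g : List.Vector ℕ (n + 2) → ℕ}
    (hf : Programmable f) (hg : Programmable g) :
    Programmable fun v : List.Vector ℕ (n + 1) =>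
      v.head.rec (f v.tail) fun y ih => g (y ::ᵥ ih ::ᵥ v.tail) := by
  intro arg b harg
  have harg₀ := harg 0
  obtain ⟨P, hP⟩ := hf (fun i => arg i.succ) b fun i => harg _
  obtain ⟨P', hP'⟩ := exists_program_prec_step hg fun i => harg (Fin.succ i)
  refine ⟨P * (assign (arg 0) (b + 1) (b + 2) * loop (b + 1) P'), fun s => ?_⟩
  let F : List.Vector ℕ n → ℕ → ℕ := fun w k => k.rec (f w) fun y ih => g (y ::ᵥ ih ::ᵥ w)
  let w : List.Vector ℕ n := .ofFn fun i => s (arg i.succ)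
  let I : (ℕ → ℕ) → Prop := fun t =>
    t b = F w (t (b + 2)) ∧ t (b + 1) + t (b + 2) = s (arg 0) ∧ ∀ j < b, t j = s j
  have hloop : ∀ u, I u → u (b + 1) ≠ 0 → Ensures Instr.Step P'
      (Function.update u (b + 1) (u (b + 1) - 1)) fun t => I t ∧ t (b + 1) = u (b + 1) - 1 := by
    refine fun u ⟨hub, hcount, hu⟩ hne => (hP' _).mono fun t ⟨htb, ht₁, ht₂, ht⟩ => ?_
    have hne' : ∀ j, j ≠ b + 1 → Function.update u (b + 1) (u (b + 1) - 1) j = u j :=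
      fun j hj => Function.update_of_ne hj ..
    rw [Function.update_self] at ht₁
    rw [hne' _ (by omega)] at ht₂
    refine ⟨⟨?_, by omega, fun j hj => by rw [ht j hj, hne' j (by omega), hu j hj]⟩, ht₁⟩
    have hw : List.Vector.ofFn (fun i : Fin n =>
        Function.update u (b + 1) (u (b + 1) - 1) (arg i.succ)) = w :=
      congrArg _ (funext fun i => by
        rw [hne' _ ((harg _).trans (Nat.lt_succ_self b)).ne, hu _ (harg _)])
    rw [htb, ht₂, hne' _ (by omega), hne' _ (by omega), hub, hw]
  refine (hP s).mul fun u ⟨hub, hu⟩ => (ensures_assign (by omega) (by omega) (by omega) u).mul_of_eq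
    ((ensures_loop hloop ?_).mono fun t ⟨⟨htb, hcount, ht⟩, h0⟩ => ⟨?_, ht⟩)
  · refine ⟨?_, ?_, fun j hj => ?_⟩
    · rw [Function.update_of_ne (by omega), Function.update_of_ne (by omega),
        Function.update_of_ne (by omega), Function.update_self]
      exact hub
    · simpa using hu _ harg₀
    · rw [Function.update_of_ne (by omega), Function.update_of_ne (by omega), hu j hj]
  · rw [htb, show t (b + 2) = s (arg 0) by omega]
    rfl

theorem programmable_of_primrec' {n : ℕ} {f : List.Vector ℕ n → ℕ} (hf : Nat.Primrec' f) :
    Programmable f := by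
  induction hf with
  | zero => exact programmable_zero
  | succ => exact programmable_succ
  | get i => exact programmable_get i
  | comp g _ _ hf hg => exact programmable_comp hf hg
  | prec _ _ hf hg => exact programmable_prec hf hg

theorem denote_star_inc_iff {i : ι} {s t : ι → ℕ} :
    Denote Instr.Step (char (.inc i)).star s t ↔ ∃ n, t = Function.update s i (s i + n) := by
  constructor
  · intro h
    induction (h : Relation.ReflTransGen _ s t) with
    | refl => exact ⟨0, by simp⟩
    | tail _ hut ih =>
      obtain ⟨n, rfl⟩ := ih
      exact ⟨n + 1, by simpa [Denote, Instr.Step, add_assoc] using hut⟩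
  · rintro ⟨n, rfl⟩
    change Relation.ReflTransGen _ _ _
    induction n with
    | zero => simpa using .refl
    | succ n ih => exact ih.tail (by simp [Denote, Instr.Step, add_assoc])

theorem exists_program_of_primrec₂ {f : ℕ → ℕ → ℕ} (hf : Primrec₂ f) :
    ∃ P, ∀ n, (∃ t, Denote Instr.Step P (Pi.single 0 n) t) ↔ ∃ y, f n y = 0 := by
  obtain ⟨P, hP⟩ := programmable_of_primrec' (Nat.Primrec'.prim_iff₂.2 hf) ![0, 1] 2 (by decide)
  have hPf : ∀ n y, Ensures Instr.Step P (Function.update (Pi.single 0 n) 1 y) (· 2 = f n y) :=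
    fun n y => (hP _).mono fun t ht => by simpa using ht.1
  refine ⟨(char (.inc 1)).star * P * char (.test 2), fun n => ⟨?_, ?_⟩⟩
  · rintro ⟨t, _, ⟨u, hu, hut⟩, ht, rfl⟩
    obtain ⟨y, rfl⟩ := denote_star_inc_iff.1 hu
    rw [Pi.single_eq_of_ne one_ne_zero, zero_add] at hut
    exact ⟨y, ((hPf n y).2 t hut).symm.trans ht⟩
  · rintro ⟨y, hy⟩
    obtain ⟨⟨t, hut⟩, ht⟩ := hPf n y
    exact ⟨t, t, ⟨_, denote_star_inc_iff.2 ⟨y, by simp⟩, hut⟩, (ht t hut).trans hy, rfl⟩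

theorem exists_program_of_rePred {p : ℕ → Prop} (hp : REPred p) :
    ∃ P, ∀ n, (∃ t, Denote Instr.Step P (Pi.single 0 n) t) ↔ p n := by
  obtain ⟨c, hc⟩ := Nat.Partrec.Code.exists_code.1
    (Partrec.nat_iff.1 (hp.map (Computable.const 0).to₂))
  have hdom : ∀ n, (c.eval n).Dom ↔ p n := fun n => by simp [hc, Part.assert]
  have hf : Primrec₂ fun n k => bif (c.evaln k n).isSome then 0 else 1 :=
    .cond (Primrec.option_isSome.comp (Nat.Partrec.Code.primrec_evaln.comp
      ((Primrec.snd.pair (.const c)).pair .fst))) (.const 0) (.const 1)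
  obtain ⟨P, hP⟩ := exists_program_of_primrec₂ hf
  refine ⟨P, fun n => (hP n).trans ?_⟩
  simp only [← hdom, Part.dom_iff_mem, Nat.Partrec.Code.evaln_complete]
  rw [exists_comm]
  exact exists_congr fun k => by cases c.evaln k n <;> simp

end PrimitiveRecursion

section GodelNumbering

theorem denote_drain_zero_iff {n : ℕ} {l : List (Fin 2)} (hl : 0 ∉ l) {a b : ℕ} {t : Fin 2 → ℕ} :
    Denote Instr.Step (drain n 0 l) ![a, b] t ↔ ∃ k, a = n * k ∧ t = ![0, b + k * l.count 1] := by
  simp [denote_drain_iff hl, funext_iff, Fin.forall_fin_two]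

theorem denote_drain_one_iff {n : ℕ} {l : List (Fin 2)} (hl : 1 ∉ l) {a b : ℕ} {t : Fin 2 → ℕ} :
    Denote Instr.Step (drain n 1 l) ![a, b] t ↔ ∃ k, b = n * k ∧ t = ![a + k * l.count 0, 0] := by
  simp [denote_drain_iff hl, funext_iff, Fin.forall_fin_two]

/-- Multiplies the first counter by `p`, using the second one as scratch space. -/
def mulBy (p : ℕ) : RegularExpression (Instr (Fin 2)) :=
  drain 1 0 (.replicate p 1) * drain 1 1 [0]

theorem denote_mulBy_iff {p N : ℕ} {t : Fin 2 → ℕ} :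
    Denote Instr.Step (mulBy p) ![N, 0] t ↔ t = ![p * N, 0] := by
  simp [mulBy, Denote, Relation.Comp, denote_drain_zero_iff, denote_drain_one_iff, mul_comm,
    List.mem_replicate]

/-- Divides the first counter by `p` and blocks if it is not divisible by `p`. -/
def divBy (p : ℕ) : RegularExpression (Instr (Fin 2)) :=
  drain p 0 [1] * drain 1 1 [0]

theorem denote_divBy_iff {p N : ℕ} {t : Fin 2 → ℕ} :
    Denote Instr.Step (divBy p) ![N, 0] t ↔ ∃ M, N = p * M ∧ t = ![M, 0] := by
  simp [divBy, Denote, Relation.Comp, denote_drain_zero_iff, denote_drain_one_iff]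

/-- Checks that the first counter is at least `r` and congruent to `r` modulo `p`. -/
def testMod (p r : ℕ) : RegularExpression (Instr (Fin 2)) :=
  transfer r 0 (.replicate r 1) * drain p 0 (.replicate p 1) * drain 1 1 [0]

theorem denote_testMod_iff {p r N : ℕ} {t : Fin 2 → ℕ} :
    Denote Instr.Step (testMod p r) ![N, 0] t ↔ (∃ k, N = r + p * k) ∧ t = ![N, 0] := by
  have htransfer : ∀ u, Denote Instr.Step (transfer r 0 (.replicate r 1)) ![N, 0] u ↔
      r ≤ N ∧ u = ![N - r, r] := fun u => by
    simp [denote_transfer_iff, funext_iff, Fin.forall_fin_two, List.count_replicate]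
  have h₀ : (0 : Fin 2) ∉ List.replicate p (1 : Fin 2) := by simp [List.mem_replicate]
  have h₁ : (1 : Fin 2) ∉ [(0 : Fin 2)] := by simp
  constructor
  · rintro ⟨v, ⟨u, hu, huv⟩, hvt⟩
    obtain ⟨hr, rfl⟩ := (htransfer u).1 hu
    obtain ⟨k, hk, rfl⟩ := (denote_drain_zero_iff h₀).1 huv
    obtain ⟨m, hm, rfl⟩ := (denote_drain_one_iff h₁).1 hvt
    have hN : N = r + p * k := by omega
    rw [List.count_replicate_self, mul_comm, ← hN, one_mul] at hm
    exact ⟨⟨k, hN⟩, by simp [← hm]⟩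
  · rintro ⟨⟨k, rfl⟩, rfl⟩
    refine ⟨_, ⟨_, (htransfer _).2 ⟨Nat.le_add_right .., rfl⟩,
      (denote_drain_zero_iff h₀).2 ⟨k, Nat.add_sub_cancel_left .., rfl⟩⟩,
      (denote_drain_one_iff h₁).2 ⟨r + p * k, ?_, ?_⟩⟩
    · rw [List.count_replicate_self, mul_comm, one_mul]
    · simp

/-- Checks that the first counter is not divisible by `p`. -/
def testNotDvd (p : ℕ) : RegularExpression (Instr (Fin 2)) :=
  ((List.range' 1 (p - 1)).map (testMod p)).sum

theorem denote_testNotDvd_iff {p N : ℕ} (hp : p ≠ 0) {t : Fin 2 → ℕ} :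
    Denote Instr.Step (testNotDvd p) ![N, 0] t ↔ ¬ p ∣ N ∧ t = ![N, 0] := by
  simp only [testNotDvd, denote_list_sum, List.mem_map, exists_exists_and_eq_and,
    denote_testMod_iff, List.mem_range'_1, ← and_assoc, exists_and_right]
  refine and_congr_left fun _ => ⟨?_, fun h => ?_⟩
  · rintro ⟨r, ⟨hr, hrp⟩, k, rfl⟩ h
    exact Nat.not_dvd_of_pos_of_lt hr (by omega) ((Nat.dvd_add_left ⟨k, rfl⟩).1 h)
  · have hpos := Nat.pos_of_ne_zero (mt Nat.dvd_of_mod_eq_zero h)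
    have hlt := Nat.mod_lt N (Nat.pos_of_ne_zero hp)
    exact ⟨N % p, ⟨hpos, by omega⟩, N / p, (Nat.mod_add_div N p).symm⟩

variable {ι : Type*}

/-- Translates an instruction on the counters `s` into a program working on the Gödel number
`∏ i, p i ^ s i`. -/
def godelProgram (p : ι → ℕ) : Instr ι → RegularExpression (Instr (Fin 2))
  | .inc i => mulBy (p i)
  | .dec i => divBy (p i)
  | .test i => testNotDvd (p i)

/-- The effect of an instruction on Gödel numbers. -/
def GodelStep (p : ι → ℕ) : Instr ι → ℕ → ℕ → Prop
  | .inc i, N, M => M = p i * N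
  | .dec i, N, M => N = p i * M
  | .test i, N, M => ¬ p i ∣ N ∧ M = N

/-- The counter values with Gödel number `N`. -/
def godelDecode (p : ι → ℕ) (N : ℕ) : ι → ℕ := fun i => N.factorization (p i)

theorem denote_godelProgram_iff {p : ι → ℕ} (hp : ∀ i, (p i).Prime) {a : Instr ι} {N : ℕ}
    {t : Fin 2 → ℕ} :
    Denote Instr.Step (godelProgram p a) ![N, 0] t ↔ ∃ M, GodelStep p a N M ∧ t = ![M, 0] := by
  cases a with
  | inc i => simp [godelProgram, GodelStep, denote_mulBy_iff]
  | dec i => exact denote_divBy_iff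
  | test i =>
    simp [godelProgram, GodelStep, denote_testNotDvd_iff (hp i).ne_zero, and_assoc]

variable [DecidableEq ι]

theorem godelDecode_mul {p : ι → ℕ} (hp : ∀ i, (p i).Prime) (hinj : p.Injective) {N : ℕ}
    (hN : N ≠ 0) (i : ι) : godelDecode p (p i * N) =
      Function.update (godelDecode p N) i (godelDecode p N i + 1) := by
  ext j
  simp only [godelDecode, Nat.factorization_mul (hp i).ne_zero hN, (hp i).factorization,
    Finsupp.add_apply, Finsupp.single_apply, Function.update_apply, hinj.eq_iff]
  grind

theorem godelStep_iff {p : ι → ℕ} (hp : ∀ i, (p i).Prime) (hinj : p.Injective) {a : Instr ι}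
    {N : ℕ} (hN : N ≠ 0) {t : ι → ℕ} :
    a.Step (godelDecode p N) t ↔ ∃ M, GodelStep p a N M ∧ t = godelDecode p M := by
  cases a with
  | inc i => simp [Instr.Step, GodelStep, godelDecode_mul hp hinj hN]
  | dec i =>
    have hdvd : godelDecode p N i ≠ 0 ↔ p i ∣ N :=
      ((hp i).dvd_iff_one_le_factorization hN).trans Nat.one_le_iff_ne_zero |>.symm
    rw [Instr.Step, hdvd]
    constructor
    · rintro ⟨⟨M, rfl⟩, rfl⟩
      refine ⟨M, rfl, ?_⟩
      simp [godelDecode_mul hp hinj (right_ne_zero_of_mul hN)]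
    · rintro ⟨M, rfl, rfl⟩
      refine ⟨⟨M, rfl⟩, ?_⟩
      simp [godelDecode_mul hp hinj (right_ne_zero_of_mul hN)]
  | test i =>
    have hdvd : godelDecode p N i = 0 ↔ ¬ p i ∣ N := by
      simp [godelDecode, Nat.factorization_eq_zero_iff, hp, hN]
    simp [Instr.Step, GodelStep, hdvd, and_assoc]

theorem denote_godel_iff {p : ι → ℕ} (hp : ∀ i, (p i).Prime) (hinj : p.Injective)
    (P : RegularExpression (Instr ι)) {N : ℕ} (hN : N ≠ 0) :
    (∃ t, Denote Instr.Step (regexSubst (godelProgram p) P) ![N, 0] t) ↔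
      ∃ t, Denote Instr.Step P (godelDecode p N) t := by
  have hGodel : ∀ {a N M}, N ≠ 0 → GodelStep p a N M → M ≠ 0 := by
    rintro (i | i | i) N M hN h
    exacts [h ▸ mul_ne_zero (hp i).ne_zero hN, right_ne_zero_of_mul (h ▸ hN), h.2 ▸ hN]
  let Encodes : (ι → ℕ) → (Fin 2 → ℕ) → Prop := fun s c =>
    ∃ N ≠ 0, s = godelDecode p N ∧ c = ![N, 0]
  have henc : Encodes (godelDecode p N) ![N, 0] := ⟨N, hN, rfl, rfl⟩
  rw [denote_regexSubst]
  constructor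
  · rintro ⟨t, ht⟩
    refine (denote_simulation (ρ' := Instr.Step) (E := flip Encodes)
      (fun a c s c' => ?_) henc ht).imp fun _ => And.left
    rintro ⟨N, hN, rfl, rfl⟩ h
    obtain ⟨M, hM, rfl⟩ := (denote_godelProgram_iff hp).1 h
    exact ⟨_, (godelStep_iff hp hinj hN).2 ⟨M, hM, rfl⟩, M, hGodel hN hM, rfl, rfl⟩
  · rintro ⟨t, ht⟩
    refine (denote_simulation (ρ' := fun a => Denote Instr.Step (godelProgram p a)) (E := Encodes)
      (fun a s c s' => ?_) henc ht).imp fun _ => And.left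
    rintro ⟨N, hN, rfl, rfl⟩ h
    obtain ⟨M, hM, rfl⟩ := (godelStep_iff hp hinj hN).1 h
    exact ⟨_, (denote_godelProgram_iff hp).2 ⟨M, hM, rfl⟩, M, hGodel hN hM, rfl, rfl⟩

theorem godelDecode_pow {p : ι → ℕ} (hp : ∀ i, (p i).Prime) (hinj : p.Injective) (i : ι) (n : ℕ) :
    godelDecode p (p i ^ n) = Pi.single i n := by
  ext j
  simp [godelDecode, (hp i).factorization_pow, Finsupp.single_apply, Pi.single_apply,
    hinj.eq_iff, eq_comm]

theorem exists_isRegular_of_rePred {p : ℕ → Prop} (hp : REPred p) :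
    ∃ L : Language (Instr (Fin 2)), L.IsRegular ∧
      ∀ n, (∃ w ∈ L, ∃ c, Exec Instr.Step w ![2 ^ n, 0] c) ↔ p n := by
  obtain ⟨P, hP⟩ := exists_program_of_rePred hp
  have hprime : ∀ i, (Nat.nth Nat.Prime i).Prime := Nat.prime_nth_prime
  have hinj : (Nat.nth Nat.Prime).Injective := Nat.nth_injective Nat.infinite_setOfPred_prime
  refine ⟨_, isRegular_matches' (regexSubst (godelProgram (Nat.nth Nat.Prime)) P), fun n => ?_⟩
  rw [← hP, ← godelDecode_pow hprime hinj,
    ← denote_godel_iff hprime hinj P (pow_ne_zero n (hprime 0).ne_zero), Nat.nth_prime_zero_eq_two]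
  simp only [denote_iff_exists_mem_matches']
  tauto

end GodelNumbering

section HistoryDeterminism

namespace VASS

variable {k : ℕ} {α Q : Type} {V : VASS k α Q}

/-- Some transition over `a` leads from `c` to `c'`. -/
def LetterStep (V : VASS k α Q) (a : α) (c c' : VASSConfig k Q) : Prop :=
  ∃ t, t.letter = a ∧ V.Step c t c'

theorem exec_letterStep_iff {w : List α} {c c' : VASSConfig k Q} :
    Exec V.LetterStep w c c' ↔ ∃ ρ, V.Run c ρ c' ∧ ρ.map VASSTransition.letter = w := by
  induction w generalizing c with
  | nil =>
    constructor
    · rintro rfl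
      exact ⟨[], .nil c, rfl⟩
    · rintro ⟨ρ, h, hρ⟩
      obtain rfl := List.map_eq_nil_iff.1 hρ
      cases h
      rfl
  | cons a w ih =>
    constructor
    · rintro ⟨d, ⟨t, rfl, ht⟩, hw⟩
      obtain ⟨ρ, hρ, rfl⟩ := ih.1 hw
      exact ⟨t :: ρ, .cons ht hρ, rfl⟩
    · rintro ⟨ρ, h, hρ⟩
      obtain ⟨t, ρ', rfl, rfl, hw⟩ := List.map_eq_cons_iff.1 hρ
      obtain _ | ⟨ht, h⟩ := h
      exact ⟨_, ⟨t, rfl, ht⟩, ih.2 ⟨ρ', h, hw⟩⟩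

theorem mem_language_iff {w : List α} :
    w ∈ V.language ↔ ∃ c, Exec V.LetterStep w V.init c ∧ V.Accepting c := by
  simp only [exec_letterStep_iff]
  constructor
  · rintro ⟨ρ, c, hρ, hc, hw⟩
    exact ⟨c, ⟨ρ, hρ, hw⟩, hc⟩
  · rintro ⟨c, ⟨ρ, hρ, hw⟩, hc⟩
    exact ⟨ρ, c, hρ, hc, hw⟩

theorem exists_isResolver_preserving (V : VASS k α Q) (I : List α → VASSConfig k Q → Prop) :
    ∃ r, V.IsResolver r ∧ ∀ (h : VASSHistory k α Q) (c c' : VASSConfig k Q) (a : α),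
      V.LetterStep a c c' → I (h.map (·.2.letter) ++ [a]) c' →
        ∃ t d, r h c a = some t ∧ t.letter = a ∧ V.Step c t d ∧
          I (h.map (·.2.letter) ++ [a]) d := by
  suffices ∀ (h : VASSHistory k α Q) (c : VASSConfig k Q) (a : α), ∃ o,
      ((∀ t, o = some t → t.letter = a ∧ ∃ c', V.Step c t c') ∧
        (o = none → ¬ ∃ t c', t.letter = a ∧ V.Step c t c')) ∧
      ∀ c', V.LetterStep a c c' → I (h.map (·.2.letter) ++ [a]) c' →
        ∃ t d, o = some t ∧ t.letter = a ∧ V.Step c t d ∧ I (h.map (·.2.letter) ++ [a]) d by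
    choose r hr hI using this
    exact ⟨r, hr, fun h c c' a => hI h c a c'⟩
  intro h c a
  by_cases hgood : ∃ c', V.LetterStep a c c' ∧ I (h.map (·.2.letter) ++ [a]) c'
  · obtain ⟨d, ⟨t, rfl, ht⟩, hd⟩ := hgood
    refine ⟨some t, ⟨?_, by simp⟩, fun _ _ _ => ⟨t, d, rfl, rfl, ht, hd⟩⟩
    rintro _ ⟨⟩
    exact ⟨rfl, d, ht⟩
  have hbad c' (hc' : V.LetterStep a c c') (hI : I (h.map (·.2.letter) ++ [a]) c') {p : Prop} : p :=
    (hgood ⟨c', hc', hI⟩).elim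
  by_cases hstep : ∃ t c', t.letter = a ∧ V.Step c t c'
  · obtain ⟨t, d, rfl, ht⟩ := hstep
    refine ⟨some t, ⟨?_, by simp⟩, fun c' hc' hI => hbad c' hc' hI⟩
    rintro _ ⟨⟩
    exact ⟨rfl, d, ht⟩
  · exact ⟨none, ⟨by simp, fun _ => hstep⟩, fun c' hc' hI => hbad c' hc' hI⟩

theorem isHistoryDeterministic_of_invariant (I : List α → VASSConfig k Q → Prop)
    (hinit : I [] V.init)
    (hstep : ∀ w a c d, I w c → Exec V.LetterStep (w ++ [a]) V.init d →
      ∃ c', V.LetterStep a c c' ∧ I (w ++ [a]) c')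
    (hacc : ∀ w c, I w c → w ∈ V.language → V.Accepting c) : V.IsHistoryDeterministic := by
  obtain ⟨r, hr, hI⟩ := V.exists_isResolver_preserving I
  suffices ∀ w d, Exec V.LetterStep w V.init d →
      ∃ h c, V.ResolvedRun r w h c ∧ h.map (·.2.letter) = w ∧ I w c by
    refine ⟨r, hr, fun w hw => ?_⟩
    obtain ⟨d, hd, -⟩ := mem_language_iff.1 hw
    obtain ⟨h, c, hrun, -, hc⟩ := this w d hd
    exact ⟨h, c, hrun, hacc w c hc hw⟩
  intro w
  induction w using List.reverseRecOn with
  | nil => exact fun _ _ => ⟨[], V.init, .nil, rfl, hinit⟩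
  | append_singleton w a ih =>
    intro d hd
    obtain ⟨d', hd', -⟩ := exec_concat V.LetterStep w a ▸ hd
    obtain ⟨h, c, hrun, rfl, hc⟩ := ih d' hd'
    obtain ⟨c', hstep, hc'⟩ := hstep _ a c d hc hd
    obtain ⟨t, e, hrt, rfl, hte, he⟩ := hI h c c' a hstep hc'
    exact ⟨_, e, .snoc hrun hrt hte, by simp, he⟩

end VASS

end HistoryDeterminism

section DebtVASS

variable {k : ℕ} {α Q : Type} [Finite α] [Finite Q]

/-- The VASS with initial configuration `c₀`, accepting control states `F` and control relation `R`
which executes the instructions `op a` without checking zero tests. The control state `q` owes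
`debt q i` units to the counter `i`: this amount is missing from the actual counter. -/
noncomputable def debtVASS (op : α → Instr (Fin k)) (R : α → Q → Q → Prop) (debt : Q → Fin k → ℕ)
    (F : Set Q) (c₀ : VASSConfig k Q) : VASS k α Q where
  init := c₀
  final := (Set.toFinite ((fun q => (q, 0)) '' F)).toFinset
  trans := (Set.toFinite ((fun x : Q × α × Q => ⟨x.1, x.2.1,
    fun i => (op x.2.1).effect i + debt x.1 i - debt x.2.2 i, x.2.2⟩) ''
      {x | R x.2.1 x.1 x.2.2})).toFinset

variable {op : α → Instr (Fin k)} {R : α → Q → Q → Prop} {debt : Q → Fin k → ℕ} {F : Set Q}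
  {c₀ : VASSConfig k Q}

theorem debtVASS_letterStep_iff {a : α} {c c' : VASSConfig k Q} :
    (debtVASS op R debt F c₀).LetterStep a c c' ↔
      R a c.1 c'.1 ∧ (op a).WeakStep (c.2 + debt c.1) (c'.2 + debt c'.1) := by
  simp only [VASS.LetterStep, VASS.Step, debtVASS, Set.Finite.mem_toFinset, Set.mem_image,
    Set.mem_ofPred_eq, Instr.WeakStep, Pi.add_apply, Nat.cast_add]
  constructor
  · rintro ⟨_, rfl, ⟨⟨q, a, q'⟩, hR, rfl⟩, rfl, rfl, h⟩
    exact ⟨hR, fun i => by grind⟩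
  · rintro ⟨hR, h⟩
    exact ⟨_, rfl, ⟨(c.1, a, c'.1), hR, rfl⟩, rfl, rfl, fun i => by grind⟩

theorem debtVASS_accepting_iff {c : VASSConfig k Q} :
    (debtVASS op R debt F c₀).Accepting c ↔ c.1 ∈ F := by
  simp [VASS.Accepting, debtVASS]

theorem debtVASS_isDeterministic (hR : ∀ a, Relator.RightUnique (R a)) :
    (debtVASS op R debt F c₀).IsDeterministic := by
  simp only [VASS.IsDeterministic, debtVASS, Set.Finite.mem_toFinset, Set.mem_image,
    Set.mem_ofPred_eq, Prod.exists]
  rintro _ ⟨q, a, q₁, h₁, rfl⟩ _ ⟨_, _, q₂, h₂, rfl⟩ rfl rfl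
  rw [hR a h₁ h₂]

end DebtVASS

section WeakVASS

variable {k : ℕ} {α Q : Type} [Finite α] [Finite Q]

/-- The deterministic VASS which executes the instructions read without checking zero tests. -/
noncomputable def weakVASS (op : α → Instr (Fin k)) (M : DFA α Q) (u₀ : Fin k → ℕ) : VASS k α Q :=
  debtVASS op (fun a q q' => M.step q a = q') 0 M.accept (M.start, u₀)

variable {op : α → Instr (Fin k)} {M : DFA α Q} {u₀ : Fin k → ℕ}

theorem weakVASS_letterStep_iff {a : α} {c c' : VASSConfig k Q} :
    (weakVASS op M u₀).LetterStep a c c' ↔ M.step c.1 a = c'.1 ∧ (op a).WeakStep c.2 c'.2 := by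
  rw [weakVASS, debtVASS_letterStep_iff, Pi.zero_apply, Pi.zero_apply, add_zero, add_zero]

theorem weakVASS_isDeterministic : (weakVASS op M u₀).IsDeterministic :=
  debtVASS_isDeterministic fun _ _ _ _ h h' => h.symm.trans h'

theorem weakVASS_accepting_iff {c : VASSConfig k Q} :
    (weakVASS op M u₀).Accepting c ↔ c.1 ∈ M.accept :=
  debtVASS_accepting_iff

theorem exec_weakVASS_iff {w : List α} {c c' : VASSConfig k Q} :
    Exec (weakVASS op M u₀).LetterStep w c c' ↔
      M.evalFrom c.1 w = c'.1 ∧ Exec (fun a => (op a).WeakStep) w c.2 c'.2 := by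
  induction w generalizing c with
  | nil => exact Prod.ext_iff
  | cons a w ih =>
    simp only [Exec, Relation.Comp, weakVASS_letterStep_iff, ih, DFA.evalFrom_cons]
    constructor
    · rintro ⟨d, ⟨hd, hu⟩, hw, hu'⟩
      exact ⟨hd ▸ hw, d.2, hu, hu'⟩
    · rintro ⟨hw, u, hu, hu'⟩
      exact ⟨(M.step c.1 a, u), ⟨rfl, hu⟩, hw, hu'⟩

theorem mem_weakVASS_language {w : List α} :
    w ∈ (weakVASS op M u₀).language ↔
      w ∈ M.accepts ∧ ∃ u, Exec (fun a => (op a).WeakStep) w u₀ u := by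
  simp only [VASS.mem_language_iff, exec_weakVASS_iff, weakVASS_accepting_iff, M.mem_accepts]
  constructor
  · rintro ⟨c, ⟨hc, hu⟩, hacc⟩
    exact ⟨(show M.eval w = c.1 from hc) ▸ hacc, c.2, hu⟩
  · rintro ⟨hacc, u, hu⟩
    exact ⟨(M.eval w, u), ⟨rfl, hu⟩, hacc⟩

end WeakVASS

section CheatVASS

/-- The modes of an automaton looking for a wrong zero test on counters indexed by `ι`: `none`
before a wrong test is found, `some (some i)` right after a wrong test of the counter `i`, and
`some none` later on. -/
abbrev CheatMode (ι : Type*) := Option (Option ι)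

namespace CheatMode

variable {ι : Type*}

/-- What the counters lack in a mode. -/
def debt [DecidableEq ι] : CheatMode ι → ι → ℕ
  | some (some i) => Pi.single i 1
  | _ => 0

/-- The changes of mode. To expose a wrong zero test of a counter, the automaton decrements this
counter; the next transition restores it. -/
inductive Step : Instr ι → CheatMode ι → CheatMode ι → Prop
  | keep (a : Instr ι) (μ : CheatMode ι) : Step a μ (μ.map fun _ => none)
  | expose (i : ι) : Step (.test i) none (some (some i))

theorem exists_step [DecidableEq ι] {a : Instr ι} {s t : ι → ℕ} (h : a.WeakStep s t)
    (μ : CheatMode ι) : ∃ μ', Step a μ μ' ∧ μ'.debt ≤ t ∧ (μ' = none → μ = none ∧ a.Step s t) := by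
  by_cases hwrong : μ = none ∧ ∃ i, a = .test i ∧ s i ≠ 0
  · obtain ⟨rfl, i, rfl, hi⟩ := hwrong
    refine ⟨_, .expose i, fun j => ?_, nofun⟩
    have hst := h j
    simp only [Instr.effect, Pi.zero_apply, add_zero, Nat.cast_inj] at hst
    by_cases hj : j = i
    · subst hj
      simpa [debt, hst, Nat.one_le_iff_ne_zero]
    · simp [debt, hj]
  · refine ⟨_, .keep a μ, by cases μ <;> exact zero_le, fun hμ => ?_⟩
    rw [Option.map_eq_none_iff] at hμ
    exact ⟨hμ, Instr.step_iff.2 ⟨h, fun i hi => not_not.1 fun hsi => hwrong ⟨hμ, i, hi, hsi⟩⟩⟩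

theorem Step.not_step [DecidableEq ι] {a : Instr ι} {μ : CheatMode ι} (h : Step a none μ)
    (hμ : μ ≠ none) {s t : ι → ℕ} (hdebt : μ.debt ≤ t) : ¬ a.Step s t := by
  cases h with
  | keep => exact (hμ rfl).elim
  | expose i =>
    rintro ⟨hi, rfl⟩
    simpa [debt, hi] using hdebt i

end CheatMode

variable {k : ℕ} {α Q Q' : Type}

/-- The counter values which a configuration of `cheatVASS` represents, if `e` encodes its
states. -/
def trueValue (e : Q' ≃ Q × CheatMode (Fin k)) (c : VASSConfig k Q') : Fin k → ℕ :=
  c.2 + (e c.1).2.debt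

theorem debt_le_trueValue (e : Q' ≃ Q × CheatMode (Fin k)) (c : VASSConfig k Q') :
    (e c.1).2.debt ≤ trueValue e c :=
  le_add_self

theorem exists_trueValue_eq (e : Q' ≃ Q × CheatMode (Fin k)) (q : Q) (μ : CheatMode (Fin k))
    {u : Fin k → ℕ} (hu : μ.debt ≤ u) :
    ∃ c : VASSConfig k Q', e c.1 = (q, μ) ∧ trueValue e c = u :=
  ⟨(e.symm (q, μ), u - μ.debt), by simp, by simp [trueValue, tsub_add_cancel_of_le hu]⟩

variable [Finite α] [Finite Q']

/-- The history-deterministic VASS which executes the instructions read without checking zero tests,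
but accepts only after exposing a wrong one. Its states are encoded by `e`. -/
noncomputable def cheatVASS (op : α → Instr (Fin k)) (M : DFA α Q)
    (e : Q' ≃ Q × CheatMode (Fin k)) (u₀ : Fin k → ℕ) : VASS k α Q' :=
  debtVASS op
    (fun a q q' => M.step (e q).1 a = (e q').1 ∧ CheatMode.Step (op a) (e q).2 (e q').2)
    (fun q => (e q).2.debt) {q | (e q).1 ∈ M.accept ∧ (e q).2 ≠ none}
    (e.symm (M.start, none), u₀)

/-- The invariant of a run of `cheatVASS` over `w` to `c` which exposes the first wrong zero test:
as long as no wrong test has been exposed, `w` is executable with exact zero tests. -/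
def ExposesFirst (op : α → Instr (Fin k)) (M : DFA α Q) (e : Q' ≃ Q × CheatMode (Fin k))
    (u₀ : Fin k → ℕ) (w : List α) (c : VASSConfig k Q') : Prop :=
  (e c.1).1 = M.eval w ∧ Exec (fun a => (op a).WeakStep) w u₀ (trueValue e c) ∧
    ((e c.1).2 = none → Exec (fun a => (op a).Step) w u₀ (trueValue e c))

variable {op : α → Instr (Fin k)} {M : DFA α Q} {e : Q' ≃ Q × CheatMode (Fin k)} {u₀ : Fin k → ℕ}

theorem cheatVASS_letterStep_iff {a : α} {c c' : VASSConfig k Q'} :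
    (cheatVASS op M e u₀).LetterStep a c c' ↔
      (M.step (e c.1).1 a = (e c'.1).1 ∧ CheatMode.Step (op a) (e c.1).2 (e c'.1).2) ∧
        (op a).WeakStep (trueValue e c) (trueValue e c') :=
  debtVASS_letterStep_iff

theorem cheatVASS_accepting_iff {c : VASSConfig k Q'} :
    (cheatVASS op M e u₀).Accepting c ↔ (e c.1).1 ∈ M.accept ∧ (e c.1).2 ≠ none :=
  debtVASS_accepting_iff

theorem trueValue_cheatVASS_init : trueValue e (cheatVASS op M e u₀).init = u₀ := by
  simp [trueValue, cheatVASS, debtVASS, CheatMode.debt]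

theorem exposesFirst_nil : ExposesFirst op M e u₀ [] (cheatVASS op M e u₀).init := by
  simp only [ExposesFirst, trueValue_cheatVASS_init]
  exact ⟨by simp [cheatVASS, debtVASS], rfl, fun _ => rfl⟩

theorem exec_cheatVASS {w : List α} {c : VASSConfig k Q'}
    (h : Exec (cheatVASS op M e u₀).LetterStep w (cheatVASS op M e u₀).init c) :
    (e c.1).1 = M.eval w ∧ Exec (fun a => (op a).WeakStep) w u₀ (trueValue e c) := by
  induction w using List.reverseRecOn generalizing c with
  | nil =>
    obtain rfl := h
    exact ⟨exposesFirst_nil.1, exposesFirst_nil.2.1⟩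
  | append_singleton w a ih =>
    obtain ⟨d, hd, hdc⟩ := exec_concat _ w a ▸ h
    obtain ⟨⟨hstep, -⟩, hweak⟩ := cheatVASS_letterStep_iff.1 hdc
    obtain ⟨hd, hu⟩ := ih hd
    rw [exec_concat, DFA.eval_append_singleton, ← hd, hstep]
    exact ⟨rfl, _, hu, hweak⟩

theorem not_exec_step_of_ne_none {w : List α} {c : VASSConfig k Q'}
    (h : Exec (cheatVASS op M e u₀).LetterStep w (cheatVASS op M e u₀).init c)
    (hc : (e c.1).2 ≠ none) (x : Fin k → ℕ) : ¬ Exec (fun a => (op a).Step) w u₀ x := by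
  induction w using List.reverseRecOn generalizing c x with
  | nil =>
    obtain rfl := h
    simp [cheatVASS, debtVASS] at hc
  | append_singleton w a ih =>
    intro hx
    obtain ⟨d, hd, hdc⟩ := exec_concat _ w a ▸ h
    obtain ⟨y, hy, hyx⟩ := exec_concat _ w a ▸ hx
    obtain ⟨⟨-, hmode⟩, hweak⟩ := cheatVASS_letterStep_iff.1 hdc
    by_cases hd0 : (e d.1).2 = none
    · obtain rfl := exec_weakStep_rightUnique op w (exec_cheatVASS hd).2
        (hy.mono fun _ _ _ => Instr.Step.weakStep)
      obtain rfl := (op a).weakStep_rightUnique hweak hyx.weakStep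
      exact (hd0 ▸ hmode).not_step hc (debt_le_trueValue e c) hyx
    · exact ih hd hd0 y hy

theorem ExposesFirst.exists_letterStep {w : List α} {a : α} {c : VASSConfig k Q'}
    {u : Fin k → ℕ} (h : ExposesFirst op M e u₀ w c) (hu : (op a).WeakStep (trueValue e c) u) :
    ∃ c', (cheatVASS op M e u₀).LetterStep a c c' ∧ ExposesFirst op M e u₀ (w ++ [a]) c' := by
  obtain ⟨hc, hweak, hexact⟩ := h
  obtain ⟨μ, hmode, hdebt, hnone⟩ := CheatMode.exists_step hu (e c.1).2
  obtain ⟨c', hc', rfl⟩ := exists_trueValue_eq e (M.step (e c.1).1 a) μ hdebt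
  refine ⟨c', cheatVASS_letterStep_iff.2 ⟨by rw [hc']; exact ⟨rfl, hmode⟩, hu⟩, ?_⟩
  rw [ExposesFirst, exec_concat, exec_concat, DFA.eval_append_singleton, hc', hc]
  exact ⟨rfl, ⟨_, hweak, hu⟩, fun h => ⟨_, hexact (hnone h).1, (hnone h).2⟩⟩

theorem exists_exec_exposesFirst {w : List α} {u : Fin k → ℕ}
    (h : Exec (fun a => (op a).WeakStep) w u₀ u) :
    ∃ c, Exec (cheatVASS op M e u₀).LetterStep w (cheatVASS op M e u₀).init c ∧
      ExposesFirst op M e u₀ w c := by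
  induction w using List.reverseRecOn generalizing u with
  | nil => exact ⟨_, rfl, exposesFirst_nil⟩
  | append_singleton w a ih =>
    obtain ⟨v, hv, hvu⟩ := exec_concat _ w a ▸ h
    obtain ⟨c, hrun, hc⟩ := ih hv
    obtain rfl := exec_weakStep_rightUnique op w hv hc.2.1
    obtain ⟨c', hcc', hc'⟩ := hc.exists_letterStep hvu
    exact ⟨c', exec_concat _ w a ▸ ⟨c, hrun, hcc'⟩, hc'⟩

theorem ExposesFirst.accepting {w : List α} {c : VASSConfig k Q'} (h : ExposesFirst op M e u₀ w c)
    (hw : w ∈ M.accepts) (hexact : ¬ ∃ x, Exec (fun a => (op a).Step) w u₀ x) :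
    (cheatVASS op M e u₀).Accepting c :=
  cheatVASS_accepting_iff.2 ⟨h.1 ▸ hw, fun hc => hexact ⟨_, h.2.2 hc⟩⟩

theorem mem_cheatVASS_language {w : List α} :
    w ∈ (cheatVASS op M e u₀).language ↔ w ∈ M.accepts ∧
      (∃ u, Exec (fun a => (op a).WeakStep) w u₀ u) ∧
        ¬ ∃ x, Exec (fun a => (op a).Step) w u₀ x := by
  rw [VASS.mem_language_iff]
  constructor
  · rintro ⟨c, hrun, hacc⟩
    obtain ⟨hctrl, hweak⟩ := exec_cheatVASS hrun
    obtain ⟨hacc, hmode⟩ := cheatVASS_accepting_iff.1 hacc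
    exact ⟨M.mem_accepts.2 (hctrl ▸ hacc), ⟨_, hweak⟩, fun ⟨x, hx⟩ =>
      not_exec_step_of_ne_none hrun hmode x hx⟩
  · rintro ⟨hw, ⟨u, hu⟩, hexact⟩
    obtain ⟨c, hrun, hc⟩ := exists_exec_exposesFirst (M := M) (e := e) hu
    exact ⟨c, hrun, hc.accepting hw hexact⟩

theorem cheatVASS_isHistoryDeterministic : (cheatVASS op M e u₀).IsHistoryDeterministic := by
  refine VASS.isHistoryDeterministic_of_invariant (ExposesFirst op M e u₀) exposesFirst_nil ?_ ?_
  · intro w a c d hc hd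
    obtain ⟨v, hv, hvd⟩ := exec_concat _ w a ▸ (exec_cheatVASS hd).2
    obtain rfl := exec_weakStep_rightUnique op w hv hc.2.1
    exact hc.exists_letterStep hvd
  · intro w c hc hw
    obtain ⟨hw, -, hexact⟩ := mem_cheatVASS_language.1 hw
    exact hc.accepting hw hexact

theorem weakVASS_language_eq_iff [Finite Q] :
    (weakVASS op M u₀).language = (cheatVASS op M e u₀).language ↔
      ¬ ∃ w ∈ M.accepts, ∃ x, Exec (fun a => (op a).Step) w u₀ x := by
  constructor
  · rintro h ⟨w, hw, x, hx⟩
    have hweak : w ∈ (weakVASS op M u₀).language :=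
      mem_weakVASS_language.2 ⟨hw, x, hx.mono fun _ _ _ => Instr.Step.weakStep⟩
    rw [h, mem_cheatVASS_language] at hweak
    exact hweak.2.2 ⟨x, hx⟩
  · intro h
    ext w
    rw [mem_weakVASS_language, mem_cheatVASS_language, ← and_assoc, iff_self_and]
    exact fun ⟨hw, _⟩ hx => h ⟨w, hw, hx⟩

end CheatVASS

section Undecidability

namespace VASS

/-- A description of `V`, whose two lists are in an arbitrary order. -/
noncomputable def code {k m n : ℕ} (V : VASS k (Fin m) (Fin n)) : VASSCode k :=
  (m, n, ((V.init.1 : ℕ), V.init.2), V.final.toList.map fun f => ((f.1 : ℕ), f.2),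
    V.trans.toList.map fun t => ((t.src : ℕ), (t.letter : ℕ), t.eff, (t.tgt : ℕ)))

theorem isDescribedBy_code {k m n : ℕ} (V : VASS k (Fin m) (Fin n)) : V.IsDescribedBy V.code := by
  refine ⟨rfl, rfl, rfl, fun x => ?_, fun x => ?_⟩ <;>
    simp only [code, List.mem_map, Finset.mem_toList, eq_comm]

theorem computable_code {β : Type*} [Primcodable β] {k m n : ℕ} {u : β → Fin k → ℕ}
    (hu : Computable u) (q : Fin n) (F : Finset (VASSConfig k (Fin n)))
    (T : Finset (VASSTransition k (Fin m) (Fin n))) :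
    Computable fun b => (VASS.mk (q, u b) F T).code := by
  dsimp only [code]
  exact (Computable.const m).pair ((Computable.const n).pair
    (((Computable.const (q : ℕ)).pair hu).pair ((Computable.const _).pair (Computable.const _))))

end VASS

theorem computable_vec_pow (p : ℕ) : Computable fun n : ℕ => ![p ^ n, 0] := by
  have hpow : Primrec fun n : ℕ => p ^ n :=
    (Primrec.nat_iterate Primrec.id (Primrec.const 1)
      ((Primrec.nat_mul.comp (Primrec.const p) Primrec.snd).to₂)).of_eq fun n => by
        simp only [mul_left_iterate, id, mul_one]
  have hite : Primrec fun x : ℕ × Fin 2 => if x.2 = 0 then p ^ x.1 else 0 :=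
    .ite (Primrec.eq.comp .snd (.const 0)) (hpow.comp .fst) (.const 0)
  refine (Primrec.fin_curry.2 (hite.of_eq ?_)).to_comp
  rintro ⟨n, i⟩
  fin_cases i <;> rfl

theorem exists_dfa_fin {α : Type*} [Finite α] {L : Language α} (hL : L.IsRegular) :
    ∃ (m n : ℕ) (op : Fin m ≃ α) (M : DFA (Fin m) (Fin n)), ∀ w, w ∈ M.accepts ↔ w.map op ∈ L := by
  obtain ⟨σ, _, M, rfl⟩ := hL
  obtain ⟨m, ⟨op⟩⟩ := Finite.exists_equiv_fin α
  refine ⟨m, _, op.symm, (M.reindex (Fintype.equivFin σ)).comap op.symm, fun w => ?_⟩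
  rw [DFA.accepts_comap, DFA.accepts_reindex]
  rfl

theorem exists_vass_language_eq_iff_not {p : ℕ → Prop} (hp : REPred p) :
    ∃ (m n₁ n₂ : ℕ) (A : ℕ → VASS 2 (Fin m) (Fin n₁)) (B : ℕ → VASS 2 (Fin m) (Fin n₂)),
      (Computable fun n => (A n).code) ∧ (Computable fun n => (B n).code) ∧
      (∀ n, (A n).IsDeterministic) ∧ (∀ n, (B n).IsHistoryDeterministic) ∧
      ∀ n, (A n).language = (B n).language ↔ ¬ p n := by
  obtain ⟨L, hL, hp⟩ := exists_isRegular_of_rePred hp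
  obtain ⟨m, n₁, op, M, hM⟩ := exists_dfa_fin hL
  obtain ⟨n₂, ⟨e⟩⟩ := Finite.exists_equiv_fin (Fin n₁ × CheatMode (Fin 2))
  refine ⟨m, n₁, n₂, fun n => weakVASS op M ![2 ^ n, 0], fun n => cheatVASS op M e.symm ![2 ^ n, 0],
    VASS.computable_code (computable_vec_pow 2) .., VASS.computable_code (computable_vec_pow 2) ..,
    fun _ => weakVASS_isDeterministic, fun _ => cheatVASS_isHistoryDeterministic, fun n => ?_⟩
  rw [weakVASS_language_eq_iff, ← hp]
  refine not_congr ((List.map_surjective_iff.2 op.surjective).exists.trans ?_).symm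
  simp only [hM, exec_map]

theorem exists_rePred_not_computablePred : ∃ p : ℕ → Prop, REPred p ∧ ¬ ComputablePred p := by
  refine ⟨fun n => ((Denumerable.ofNat Nat.Partrec.Code n).eval 0).Dom,
    Partrec.comp (ComputablePred.halting_problem_re 0) (Computable.ofNat _), fun h => ?_⟩
  exact ComputablePred.halting_problem 0 (ComputablePred.computable_of_manyOneReducible
    ⟨Encodable.encode, Computable.encode, fun c => by rw [Denumerable.ofNat_encode]⟩ h)

end Undecidability

/-- No algorithm (partial recursive function on pairs of descriptions) halts with the correct
answer to `L(A) = L(B)` on all descriptions of a deterministic 2-VASS `A` and a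
history-deterministic 2-VASS `B` over the same finite alphabet. Nothing is required of the
algorithm on other inputs. -/
theorem corollary3 :
    ¬ ∃ f : VASSCode 2 × VASSCode 2 →. Bool, Partrec f ∧
      ∀ (m n₁ n₂ : ℕ) (A : VASS 2 (Fin m) (Fin n₁)) (B : VASS 2 (Fin m) (Fin n₂))
        (a b : VASSCode 2), A.IsDescribedBy a → B.IsDescribedBy b →
        A.IsDeterministic → B.IsHistoryDeterministic →
        ∃ answer : Bool, answer ∈ f (a, b) ∧ (answer = true ↔ A.language = B.language) := by
  rintro ⟨f, hf, hcorrect⟩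
  obtain ⟨p, hre, hp⟩ := exists_rePred_not_computablePred
  obtain ⟨m, n₁, n₂, A, B, hA, hB, hdet, hhist, hlang⟩ := exists_vass_language_eq_iff_not hre
  have hanswer (n : ℕ) : ∃ answer : Bool, answer ∈ f ((A n).code, (B n).code) ∧
      (answer = true ↔ (A n).language = (B n).language) :=
    hcorrect m n₁ n₂ (A n) (B n) _ _ (A n).isDescribedBy_code (B n).isDescribedBy_code
      (hdet n) (hhist n)
  choose g hg hgl using hanswer
  have hcomp : Computable g := (hf.comp (hA.pair hB)).of_eq_tot hg
  refine hp (ComputablePred.computable_iff.2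
    ⟨fun n => !g n, Primrec.not.to_comp.comp hcomp, funext fun n => propext ?_⟩)
  rw [Bool.not_eq_true', ← Bool.not_eq_true, hgl, hlang, not_not]
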